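/- For $n\ge 1$ let $G_n$ be the hypercube with vertex set $\mathcal V_n=\{-1,1\}^n$, where $x,y$ are neighbours iff they differ in exactly one coordinate, and let $\boldsymbol 0=(1,\dots,1)$. Let $Y_n$ be the discrete-time simple random walk on $G_n$, let $\mathbb E_x$ be the expectation for the walk started at $x$, and for $B\subset\mathcal V_n$ let $H_n(B)=\inf\{i\ge 0: Y_n(i)\in B\}$ (with $\inf\emptyset=\infty$ and $e^{-\infty}=0$). A random set $A\subset\mathcal V_n$ is a Poisson cloud with density $p\in(0,1)$ if each site of $\mathcal V_n$ belongs to $A$ with probability $p$, independently of all the others. Let $\alpha,\beta>0$ satisfy $$\frac34<\frac{\alpha^2\beta^2}{2\log 2}<1 ,$$ and define the scales of the Random Energy Model by $$t(n)=g(n)=(\alpha\beta\sqrt{2\pi n})^{-1/\alpha}e^{\alpha\beta^2 n},\qquad r(n)=\rho(n)^{-1}=e^{\alpha^2\beta^2 n/2}.$$ Then Condition (C) holds for these graphs and scales with $\mathcal K_r=1$. That is, $r(n)\rho(n)=f(n):=t(n)/g(n)$ for all $n\ge1$, and for every $\rho\in(0,\infty)$ and all random sets $A_n\subset\mathcal V_n$,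 defined on a common probability space, such that for all sufficiently large $n$ the set $A_n$ is a Poisson cloud with density $\rho\,\rho(n)$, almost surely, for all $s>0$, $$\max_{x\in A_n\cup\{\boldsymbol 0\}}\left|\mathbb E_x\left[\exp\left(-\frac{s}{r(n)}H_n(A_n\setminus\{x\})\right)\right]-\frac{\mathcal K_r\,\rho}{s+\mathcal K_r\,\rho}\right|\xrightarrow[n\to\infty]{}0 ,\qquad \mathcal K_r=1 .$$ -/

import Mathlib

open MeasureTheory ProbabilityTheory Filter Topology

universe u v

noncomputable section

namespace TrapModel

/-! ### Simple random walk on a finite graph -/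

section Walk

variable {V : Type*} [Fintype V] [MeasurableSpace V] [MeasurableSingletonClass V]

open Classical in
/-- One step of the simple random walk on `G` from `x`: uniform on the neighbours of `x`.
At an isolated vertex (only the one-point graph among connected graphs has one) the walk stays. -/
def stepPMF (G : SimpleGraph V) (x : V) : PMF V :=
  if h : (G.neighborFinset x).Nonempty then PMF.uniformOfFinset (G.neighborFinset x) h
  else PMF.pure x

/-- The transition kernel `p(x, ·)` of the simple random walk on `G`. -/
def stepKernel (G : SimpleGraph V) : Kernel V V :=
  Kernel.ofFunOfCountable fun x => (stepPMF G x).toMeasure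

instance (G : SimpleGraph V) : IsMarkovKernel (stepKernel G) :=
  ⟨fun x => inferInstanceAs (IsProbabilityMeasure (stepPMF G x).toMeasure)⟩

/-- The law of the next position given the path `(Y 0, …, Y k)`: one step from `Y k`. -/
def pathKernel (G : SimpleGraph V) (k : ℕ) : Kernel ((i : Finset.Iic k) → V) V :=
  (stepKernel G).comap (fun h => h ⟨k, Finset.mem_Iic.2 le_rfl⟩) (measurable_pi_apply _)

instance (G : SimpleGraph V) (k : ℕ) : IsMarkovKernel (pathKernel G k) := by
  unfold pathKernel; infer_instance

/-- The law `ℙ_x`, on the space of trajectories, of the discrete-time simple random walk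
`(Y j : j ≥ 0)` on `G` started at `x`. -/
def walkLaw (G : SimpleGraph V) (x : V) : Measure (ℕ → V) :=
  Kernel.trajMeasure (X := fun _ => V) (Measure.dirac x) (pathKernel G)

/-- The hitting time `H(B) = inf {i ≥ 0 : Y i ∈ B}` of `B`, equal to `⊤` if `B` is never hit. -/
def hittingTime (B : Set V) (Y : ℕ → V) : WithTop ℕ :=
  hittingAfter (fun (i : ℕ) (Y : ℕ → V) => Y i) B 0 Y

/-- `exp (-c h)` for a time `h ∈ ℕ ∪ {∞}`, with `exp (-∞) = 0`. -/
def expNeg (c : ℝ) : WithTop ℕ → ℝ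
  | some k => Real.exp (-(c * (k : ℝ)))
  | none => 0

/-- The Laplace transform `𝔼_x[exp (-c H(B))]` of the hitting time of `B` by the simple random
walk started at `x`. -/
def hittingLaplace (G : SimpleGraph V) (x : V) (B : Set V) (c : ℝ) : ℝ :=
  ∫ Y, expNeg c (hittingTime B Y) ∂(walkLaw G x)

end Walk

/-! ### Poisson clouds and the hitting time condition -/

/-- The random set `A` is a Poisson cloud on `V` with density `p ∈ (0, 1)`: each site belongs to
`A` with probability `p`, independently of all others. -/
structure IsPoissonCloud {V Ω : Type*} [MeasurableSpace Ω] (P : Measure Ω) (A : Ω → Set V)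
    (p : ℝ) : Prop where
  pos : 0 < p
  lt_one : p < 1
  measurableSet_mem : ∀ x, MeasurableSet {ω | x ∈ A ω}
  indep : iIndepSet (fun x => {ω | x ∈ A ω}) P
  prob_mem : ∀ x, P {ω | x ∈ A ω} = ENNReal.ofReal p

/-- Condition (C) for a sequence of graphs `G n` with distinguished vertices `o n`, a time scale
`t`, a depth scale `g`, a density scale `ρ` and a scale `r` for the number of steps, with constant
`K = 𝒦_r ∈ (0, ∞)`. The scales satisfy `r(n) ρ(n) = f(n)` with `f(n) = t(n) / g(n)`, and for every
`ρ₀ ∈ (0, ∞)` and almost every sequence `A n` of Poisson clouds with densities `ρ₀ ρ(n)`, the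
hitting time `H(A n \ {x}) / r(n)` is asymptotically exponential with mean `1 / (K ρ₀)`, uniformly
in the starting point `x ∈ A n ∪ {o n}`.

The number `ρ₀ ρ(n)` need not lie in `(0, 1)` for the first values of `n`, so `A n` is required to
be a Poisson cloud from some `n` on only. No joint law of the clouds for different `n` is
prescribed. -/
def ConditionC (V : ℕ → Type v) [∀ n, Fintype (V n)] [∀ n, MeasurableSpace (V n)]
    [∀ n, MeasurableSingletonClass (V n)] (G : (n : ℕ) → SimpleGraph (V n)) (o : (n : ℕ) → V n)
    (t g ρ r : ℕ → ℝ) (K : ℝ) : Prop :=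
  0 < K ∧
  (∀ n ≥ 1, r n * ρ n = t n / g n) ∧
  ∀ ρ₀ : ℝ, 0 < ρ₀ →
    ∀ (Ω : Type u) [MeasurableSpace Ω] (P : Measure Ω) [IsProbabilityMeasure P]
      (A : (n : ℕ) → Ω → Set (V n)),
      (∀ᶠ n in atTop, IsPoissonCloud P (A n) (ρ₀ * ρ n)) →
      ∀ᵐ ω ∂P, ∀ s : ℝ, 0 < s →
        Tendsto
          (fun n => ⨆ x : ↥(A n ω ∪ {o n}),
            |hittingLaplace (G n) (x : V n) (A n ω \ {(x : V n)}) (s / r n)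
              - K * ρ₀ / (s + K * ρ₀)|)
          atTop (𝓝 0)

/-! ### The hypercube and the scales of the Random Energy Model -/

/-- The vertex set `{-1, 1}ⁿ` of the hypercube. -/
abbrev Cube (n : ℕ) : Type := Fin n → ℤˣ

instance : MeasurableSingletonClass ℤˣ :=
  ⟨fun u => ⟨{(u : ℤ)}, measurableSet_singleton _, by ext w; simp [Units.ext_iff]⟩⟩

/-- The `n`-dimensional hypercube: `x` and `y` are neighbours if `∑ i, |x i - y i| = 2`. -/
def cubeGraph (n : ℕ) : SimpleGraph (Cube n) where
  Adj x y := ∑ i, |(x i : ℤ) - (y i : ℤ)| = 2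
  symm := ⟨fun x y h => by simpa [abs_sub_comm] using h⟩
  loopless := ⟨fun x h => by simp at h⟩

/-- The starting vertex `(1, …, 1)`. -/
def cubeOrigin (n : ℕ) : Cube n := fun _ => 1

/-- The depth scale `g(n) = (α β √(2 π n))^(-1/α) exp (α β² n)`. -/
def remG (α β : ℝ) (n : ℕ) : ℝ :=
  (α * β * √(2 * Real.pi * n)) ^ (-1 / α) * Real.exp (α * β ^ 2 * n)

/-- The time scale `t(n) = g(n)`. -/
def remT (α β : ℝ) (n : ℕ) : ℝ := remG α β n

/-- The step scale `r(n) = exp (α² β² n / 2)`. -/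
def remR (α β : ℝ) (n : ℕ) : ℝ := Real.exp (α ^ 2 * β ^ 2 * n / 2)

/-- The density scale `ρ(n) = 1 / r(n)`. -/
def remRho (α β : ℝ) (n : ℕ) : ℝ := (remR α β n)⁻¹

end TrapModel

end

namespace TrapModel

/-! ### Optional stopping for the killed walk on a finite graph -/

section WalkLemmas

variable {V : Type*} [Fintype V] [MeasurableSpace V] [MeasurableSingletonClass V]

/-! Put `q = exp (-c)` with `c = s / r(n)`, `B = A \ {x}`, and let `v y` be the sum over `z ∈ B` of
the Green function `green q y z` of the walk killed at rate `1 - q`. Off `B`, `v` equals `q` times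
its mean over the neighbours, so optional stopping gives `v x = 𝔼_x[q ^ H v(Y_H)]`, with `H` the
hitting time of `B` (`abs_sub_mul_hittingLaplace_le`).

The constant character contributes `w = 2⁻ⁿ / (1 - q)` to every value of the Green function. The
rest, `greenDev`, is `1 + O(1/n)` on the diagonal and has a negligible total over pairs of distinct
cloud points. Hence `v ≈ 1 + |B| w` on `B` and `v x ≈ |B| w`, and the Laplace transform is close to
`|B| w / (1 + |B| w)` (`abs_hittingLaplace_cube_sub_le`). With `R = exp (-α²β²/2)` one has `|B| ≈ 2ⁿ
ρ₀ Rⁿ` and `1 - q ≈ s Rⁿ`, so `|B| w → ρ₀ / s` and the limit is `ρ₀ / (s + ρ₀)`.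

The two bounds on `α²β²` control the randomness. The spectral gap, Parseval and Cauchy–Schwarz give
`∑ y, |greenDev q x y| ≤ n 2^(n/2)`, so the expected total over cloud pairs is at most of order `n
(2 √2 R²)ⁿ + n (√2 R)ⁿ`, summable when `2 √2 R² < 1`: this is the bound `3/4`. The relative variance
of the number of cloud points is at most of order `(2 R)⁻ⁿ`, summable when `2 R > 1`: this is the
bound `1`. Summability of moments gives almost sure convergence whatever the joint law of the
clouds. The exceptional null set is made independent of `s` by taking rational `s` and using
monotonicity in `s`. -/

instance (G : SimpleGraph V) (x : V) : IsProbabilityMeasure (walkLaw G x) := by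
  unfold walkLaw; infer_instance

lemma integrable_comp_frestrictLe (G : SimpleGraph V) (x : V) (k : ℕ)
    (φ : ((i : Finset.Iic k) → V) → ℝ) :
    Integrable (fun Y : ℕ → V => φ (Preorder.frestrictLe k Y)) (walkLaw G x) := by
  have h : Integrable φ ((walkLaw G x).map (Preorder.frestrictLe k)) := Integrable.of_finite
  exact h.comp_measurable (by fun_prop)

lemma integral_walkLaw_zero (G : SimpleGraph V) (x : V) (v : V → ℝ) :
    ∫ Y, v (Y 0) ∂(walkLaw G x) = v x := by
  have h : (walkLaw G x).map (Preorder.frestrictLe (π := fun _ => V) 0)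
      = Measure.dirac (fun _ => x) := by
    unfold walkLaw Kernel.trajMeasure
    rw [Measure.map_comp _ _ (by fun_prop), Kernel.traj_map_frestrictLe,
      Kernel.partialTraj_self, Measure.id_comp, Measure.map_dirac' (by fun_prop)]
    congr 1
  have h2 : ∫ Y, v (Y 0) ∂(walkLaw G x)
      = ∫ z, v (z ⟨0, Finset.mem_Iic.2 le_rfl⟩)
          ∂((walkLaw G x).map (Preorder.frestrictLe (π := fun _ => V) 0)) := by
    rw [integral_map (by fun_prop)
      (Measurable.of_discrete.aestronglyMeasurable)]
    rfl
  rw [h2, h, integral_dirac]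

/-- The Markov property of the walk, for a functional of the path up to time `k`. -/
lemma integral_walkLaw_succ (G : SimpleGraph V) (x : V) (k : ℕ)
    (φ : ((i : Finset.Iic k) → V) → ℝ) (g : V → ℝ) :
    ∫ Y, φ (Preorder.frestrictLe k Y) * g (Y (k + 1)) ∂(walkLaw G x)
      = ∫ Y, φ (Preorder.frestrictLe k Y) * (∫ z, g z ∂(stepKernel G (Y k)))
          ∂(walkLaw G x) := by
  have h := Kernel.map_frestrictLe_trajMeasure_compProd_eq_map_trajMeasure
    (X := fun _ => V) (μ₀ := Measure.dirac x) (κ := pathKernel G) (a := k)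
  have e1 : ∫ Y, φ (Preorder.frestrictLe k Y) * g (Y (k + 1)) ∂(walkLaw G x)
      = ∫ z, φ z.1 * g z.2 ∂((walkLaw G x).map
          (fun Y => (Preorder.frestrictLe (π := fun _ => V) k Y, Y (k + 1)))) := by
    rw [integral_map (by fun_prop) (Measurable.of_discrete.aestronglyMeasurable)]
  rw [e1]
  unfold walkLaw
  rw [← h, Measure.integral_compProd Integrable.of_finite,
    integral_map (by fun_prop) (Measurable.of_discrete.aestronglyMeasurable)]
  refine integral_congr_ae (Eventually.of_forall fun Y => ?_)
  simp only [integral_const_mul]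
  rfl

open Classical in
/-- The process `q ^ k * v (Y k)`, stopped when `Y` enters `B`. -/
noncomputable def stoppedWalk (B : Set V) (q : ℝ) (v : V → ℝ) (k : ℕ) (Y : ℕ → V) : ℝ :=
  v (Y 0) + ∑ j ∈ Finset.range k,
    if ∀ i ≤ j, Y i ∉ B then q ^ (j + 1) * v (Y (j + 1)) - q ^ j * v (Y j) else 0

lemma stoppedWalk_of_avoid {V : Type*} {B : Set V} {q : ℝ} {v : V → ℝ} {k : ℕ} {Y : ℕ → V}
    (h : ∀ i < k, Y i ∉ B) : stoppedWalk B q v k Y = q ^ k * v (Y k) := by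
  unfold stoppedWalk
  rw [Finset.sum_congr rfl fun j hj => if_pos fun i hi =>
    h i (lt_of_le_of_lt hi (Finset.mem_range.1 hj)),
    Finset.sum_range_sub (fun j => q ^ j * v (Y j))]
  simp

lemma stoppedWalk_of_hit {V : Type*} {B : Set V} {q : ℝ} {v : V → ℝ} {j k : ℕ} {Y : ℕ → V}
    (hjk : j ≤ k) (hj : Y j ∈ B) :
    stoppedWalk B q v k Y = stoppedWalk B q v j Y := by
  unfold stoppedWalk
  congr 1
  symm
  refine Finset.sum_subset (Finset.range_mono hjk) fun i _ hi => if_neg fun h => ?_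
  exact h j (by simpa using hi) hj

lemma integrable_stoppedWalk (G : SimpleGraph V) (x : V) (B : Set V) (q : ℝ) (v : V → ℝ)
    (k : ℕ) : Integrable (stoppedWalk B q v k) (walkLaw G x) := by
  classical
  -- A path up to time `k` is frozen after `k`; the stopped process at time `k` does not see the
  -- difference, so it is a function on a finite space.
  let e : ((i : Finset.Iic k) → V) → ℕ → V := fun h i => h ⟨min i k, by simp⟩
  have := integrable_comp_frestrictLe G x k (fun h => stoppedWalk B q v k (e h))
  refine this.congr (Eventually.of_forall fun Y => ?_)
  have he : ∀ i ≤ k, e (Preorder.frestrictLe k Y) i = Y i := fun i hi => by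
    simp [e, hi]
  unfold stoppedWalk
  simp only
  rw [he 0 (Nat.zero_le _)]
  congr 1
  refine Finset.sum_congr rfl fun j hj => ?_
  have hj' := Finset.mem_range.1 hj
  rw [he (j + 1) (by omega), he j (by omega)]
  have : (∀ i ≤ j, e (Preorder.frestrictLe k Y) i ∉ B) ↔ ∀ i ≤ j, Y i ∉ B :=
    forall₂_congr fun i hi => by rw [he i (by omega)]
  simp only [this]

/-- The stopped process is a martingale: its increment is nonzero only if the path has avoided `B`
up to time `k`, and then its conditional mean vanishes by `hv` at `Y k`. -/
lemma integral_stoppedWalk (G : SimpleGraph V) (x : V) (B : Set V) (q : ℝ) (v : V → ℝ)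
    (hv : ∀ y ∉ B, v y = q * ∫ z, v z ∂(stepKernel G y)) (k : ℕ) :
    ∫ Y, stoppedWalk B q v k Y ∂(walkLaw G x) = v x := by
  classical
  induction k with
  | zero => simpa [stoppedWalk] using integral_walkLaw_zero G x v
  | succ k ih =>
    let φ : ((i : Finset.Iic k) → V) → ℝ := fun h => if ∀ i, h i ∉ B then q ^ k else 0
    have hφ : ∀ Y : ℕ → V, φ (Preorder.frestrictLe k Y)
        = if ∀ i ≤ k, Y i ∉ B then q ^ k else 0 := fun Y => by simp [φ]; congr
    have hstep : ∀ Y : ℕ → V, stoppedWalk B q v (k + 1) Y = stoppedWalk B q v k Y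
        + (φ (Preorder.frestrictLe k Y) * (q * v (Y (k + 1)))
          - φ (Preorder.frestrictLe k Y) * v (Y k)) := fun Y => by
      rw [hφ]
      unfold stoppedWalk
      rw [Finset.sum_range_succ]
      split_ifs <;> ring
    have i1 : Integrable (fun Y : ℕ → V => φ (Preorder.frestrictLe k Y) * (q * v (Y (k + 1))))
        (walkLaw G x) :=
      integrable_comp_frestrictLe G x (k + 1) (fun h =>
        φ (fun i => h ⟨i, Finset.mem_Iic.2 ((Finset.mem_Iic.1 i.2).trans (Nat.le_succ k))⟩)
          * (q * v (h ⟨k + 1, by simp⟩)))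
    have i2 : Integrable (fun Y : ℕ → V => φ (Preorder.frestrictLe k Y) * v (Y k))
        (walkLaw G x) :=
      integrable_comp_frestrictLe G x k (fun h => φ h * v (h ⟨k, by simp⟩))
    have i0 := integrable_stoppedWalk G x B q v k
    simp only [hstep]
    rw [integral_add i0 (by exact i1.sub i2), ih, integral_sub i1 i2,
      integral_walkLaw_succ G x k φ (fun z => q * v z), add_eq_left,
      sub_eq_zero]
    refine integral_congr_ae (Eventually.of_forall fun Y => ?_)
    simp only [integral_const_mul]
    rw [hφ]
    split_ifs with h
    · rw [hv _ (h k le_rfl)]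
    · simp

lemma expNeg_coe (c : ℝ) (j : ℕ) : expNeg c (WithTop.some j) = Real.exp (-c) ^ j := by
  rw [← Real.exp_nat_mul]
  change Real.exp (-(c * (j : ℝ))) = _
  congr 1; ring

lemma expNeg_top (c : ℝ) : expNeg c ⊤ = 0 := rfl

/-- A path either avoids `B` forever or has a first entrance to `B`. -/
lemma hittingTime_cases {V : Type*} (B : Set V) (Y : ℕ → V) :
    (hittingTime B Y = ⊤ ∧ ∀ i, Y i ∉ B) ∨
      ∃ j : ℕ, hittingTime B Y = WithTop.some j ∧ Y j ∈ B ∧ ∀ i < j, Y i ∉ B := by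
  classical
  by_cases h : ∃ j, Y j ∈ B
  · refine Or.inr ⟨Nat.find h, ?_, Nat.find_spec h, fun i hi => Nat.find_min h hi⟩
    unfold hittingTime hittingAfter
    rw [if_pos (by simpa using h)]
    simp only [zero_le, true_and]
    congr 1
    exact (Nat.sInf_def (s := {i | Y i ∈ B}) h).trans (by congr)
  · push Not at h
    exact Or.inl ⟨by simpa [hittingTime, hittingAfter_eq_top_iff] using h, h⟩

/-- If `B` is entered at time `j ≤ k`, the stopped value is `q ^ j * v (Y j)`, within `ε` of `C * q
^ j`. Otherwise both terms carry a factor at most `q ^ k`. -/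
lemma abs_stoppedWalk_sub_le {V : Type*} {B : Set V} {c : ℝ} (hc : 0 < c) {v : V → ℝ} {C ε K : ℝ}
    (hC : 0 ≤ C) (hε : 0 ≤ ε) (hvB : ∀ y ∈ B, |v y - C| ≤ ε) (hK : ∀ y, |v y| ≤ K) (k : ℕ)
    (Y : ℕ → V) :
    |stoppedWalk B (Real.exp (-c)) v k Y - C * expNeg c (hittingTime B Y)|
      ≤ ε + (K + C) * Real.exp (-c) ^ k := by
  set q := Real.exp (-c) with hq
  have hq0 : 0 ≤ q := (Real.exp_pos _).le
  have hq1 : q ≤ 1 := Real.exp_le_one_iff.2 (by linarith)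
  have hK0 : 0 ≤ K := (abs_nonneg _).trans (hK (Y 0))
  have hqk : 0 ≤ q ^ k := by positivity
  have key : ∀ L : ℝ, 0 ≤ L → L ≤ q ^ k → |q ^ k * v (Y k) - C * L| ≤ ε + (K + C) * q ^ k := by
    intro L hL0 hL
    calc |q ^ k * v (Y k) - C * L| ≤ |q ^ k * v (Y k)| + |C * L| := abs_sub _ _
      _ = q ^ k * |v (Y k)| + C * L := by
        rw [abs_mul, abs_mul, abs_of_nonneg hqk, abs_of_nonneg hC, abs_of_nonneg hL0]
      _ ≤ q ^ k * K + C * q ^ k := by gcongr; exact hK _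
      _ ≤ _ := by linarith
  rcases hittingTime_cases B Y with ⟨hH, h⟩ | ⟨j, hH, hj, h⟩
  · rw [hH, expNeg_top, stoppedWalk_of_avoid fun i _ => h i]
    exact key 0 le_rfl hqk
  · rw [hH, expNeg_coe, ← hq]
    rcases le_total j k with hjk | hjk
    · rw [stoppedWalk_of_hit hjk hj, stoppedWalk_of_avoid h, mul_comm C, ← mul_sub, abs_mul,
        abs_of_nonneg (by positivity)]
      have h1 : q ^ j * |v (Y j) - C| ≤ 1 * ε :=
        mul_le_mul (pow_le_one₀ hq0 hq1) (hvB _ hj) (abs_nonneg _) zero_le_one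
      have : 0 ≤ (K + C) * q ^ k := by positivity
      linarith
    · rw [stoppedWalk_of_avoid fun i hi => h i (by omega)]
      exact key _ (by positivity) (pow_le_pow_of_le_one hq0 hq1 hjk)

lemma integrable_expNeg_hittingTime (G : SimpleGraph V) (x : V) (B : Set V) {c : ℝ}
    (hc : 0 < c) : Integrable (fun Y => expNeg c (hittingTime B Y)) (walkLaw G x) := by
  have hq0 := Real.exp_pos (-c)
  have hq1 : Real.exp (-c) < 1 := Real.exp_lt_one_iff.2 (by linarith)
  -- With `v = 1` the stopped process converges pointwise to the discounted hitting time, which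
  -- yields measurability of the latter.
  have hlim : ∀ Y : ℕ → V, Tendsto (fun k => stoppedWalk B (Real.exp (-c)) (fun _ => 1) k Y)
      atTop (𝓝 (expNeg c (hittingTime B Y))) := fun Y => by
    rw [tendsto_iff_dist_tendsto_zero]
    refine squeeze_zero (fun _ => dist_nonneg) (fun k => ?_)
      (g := fun k => 2 * Real.exp (-c) ^ k)
      (by simpa using (tendsto_pow_atTop_nhds_zero_of_lt_one hq0.le hq1).const_mul 2)
    have := abs_stoppedWalk_sub_le (B := B) hc (v := fun _ => 1) (C := 1) (ε := 0) (K := 1)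
      zero_le_one le_rfl (by simp) (by simp) k Y
    rw [Real.dist_eq]
    simpa [one_add_one_eq_two] using this
  refine Integrable.of_bound (C := 1) (aestronglyMeasurable_of_tendsto_ae atTop
    (fun k => (integrable_stoppedWalk G x B _ _ k).aestronglyMeasurable)
    (Eventually.of_forall hlim)) (Eventually.of_forall fun Y => ?_)
  rcases hittingTime_cases B Y with ⟨hH, -⟩ | ⟨j, hH, -⟩
  · simp [hH, expNeg_top]
  · rw [hH, expNeg_coe, Real.norm_eq_abs, abs_of_nonneg (by positivity)]
    exact pow_le_one₀ hq0.le hq1.le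

/-- A function that is harmonic for the killed walk off `B` and nearly equal to the constant `C`
on `B` is nearly equal to `C` times the Laplace transform of the hitting time of `B`. -/
theorem abs_sub_mul_hittingLaplace_le (G : SimpleGraph V) (x : V) {B : Set V} {c : ℝ}
    (hc : 0 < c) {v : V → ℝ} {C ε : ℝ} (hC : 0 ≤ C) (hε : 0 ≤ ε)
    (hv : ∀ y ∉ B, v y = Real.exp (-c) * ∫ z, v z ∂(stepKernel G y))
    (hvB : ∀ y ∈ B, |v y - C| ≤ ε) :
    |v x - C * hittingLaplace G x B c| ≤ ε := by
  obtain ⟨K, hK⟩ : ∃ K, ∀ y, |v y| ≤ K := by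
    obtain ⟨K, hK⟩ := (Set.finite_range fun y => |v y|).bddAbove
    exact ⟨K, fun y => hK ⟨y, rfl⟩⟩
  have hbound : ∀ k : ℕ, |v x - C * hittingLaplace G x B c|
      ≤ ε + (K + C) * Real.exp (-c) ^ k := fun k => by
    have hi := (integrable_expNeg_hittingTime G x B hc).const_mul C
    unfold hittingLaplace
    rw [← integral_stoppedWalk G x B _ v hv k, ← integral_const_mul,
      ← integral_sub (integrable_stoppedWalk G x B _ v k) hi]
    refine (abs_integral_le_integral_abs).trans ?_
    refine (integral_mono_of_nonneg (Eventually.of_forall fun _ => abs_nonneg _)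
      (integrable_const _) (Eventually.of_forall
        (abs_stoppedWalk_sub_le hc hC hε hvB hK k))).trans ?_
    simp
  refine ge_of_tendsto' (x := atTop) ?_ hbound
  simpa using ((tendsto_pow_atTop_nhds_zero_of_lt_one (Real.exp_pos (-c)).le
    (Real.exp_lt_one_iff.2 (by linarith))).const_mul (K + C)).const_add ε

lemma expNeg_antitone {c d : ℝ} (h : c ≤ d) (τ : WithTop ℕ) : expNeg d τ ≤ expNeg c τ := by
  induction τ using WithTop.recTopCoe with
  | top => rfl
  | coe j =>
    rw [expNeg_coe, expNeg_coe]
    gcongr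

lemma hittingLaplace_antitone (G : SimpleGraph V) (x : V) (B : Set V) {c d : ℝ} (hc : 0 < c)
    (h : c ≤ d) : hittingLaplace G x B d ≤ hittingLaplace G x B c :=
  integral_mono (integrable_expNeg_hittingTime G x B (hc.trans_le h))
    (integrable_expNeg_hittingTime G x B hc) fun _ => expNeg_antitone h _

end WalkLemmas

/-! ### Neighbours in the hypercube -/

section CubeLemmas

variable {n : ℕ}

/-- The vertex obtained from `x` by changing the sign of the coordinate `i`. -/
def flipAt (x : Cube n) (i : Fin n) : Cube n := Function.update x i (-x i)

lemma flipAt_self (x : Cube n) (i : Fin n) : flipAt x i i = -x i := by simp [flipAt]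

lemma flipAt_of_ne (x : Cube n) {i j : Fin n} (h : j ≠ i) : flipAt x i j = x j := by
  simp [flipAt, h]

lemma flipAt_flipAt (x : Cube n) (i : Fin n) : flipAt (flipAt x i) i = x := by
  simp [flipAt]

lemma flipAt_injective (x : Cube n) : Function.Injective (flipAt x) := by
  intro i j h
  by_contra hij
  have h1 := congrFun h i
  rw [flipAt_self, flipAt_of_ne x hij] at h1
  exact neg_units_ne_self (x i) h1

lemma abs_units_sub (a b : ℤˣ) : |(a : ℤ) - (b : ℤ)| = if a = b then 0 else 2 := by
  rcases Int.units_eq_one_or a with rfl | rfl <;> rcases Int.units_eq_one_or b with rfl | rfl <;>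
    decide

lemma cubeGraph_adj_iff (x y : Cube n) : (cubeGraph n).Adj x y ↔ ∃ i, flipAt x i = y := by
  change ∑ i, |(x i : ℤ) - (y i : ℤ)| = 2 ↔ _
  simp only [abs_units_sub]
  constructor
  · intro h
    rw [Finset.sum_ite, Finset.sum_const_zero, zero_add, Finset.sum_const, nsmul_eq_mul] at h
    have h1 : (Finset.univ.filter fun i => ¬x i = y i).card = 1 := by
      have : ((Finset.univ.filter fun i => ¬x i = y i).card : ℤ) = 1 := by linarith
      exact_mod_cast this
    obtain ⟨i, hi⟩ := Finset.card_eq_one.1 h1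
    have hmem : ∀ j, ¬x j = y j ↔ j = i := fun j => by
      have := congrArg (fun s => j ∈ s) hi
      simpa using this
    refine ⟨i, funext fun j => ?_⟩
    by_cases hj : j = i
    · subst hj
      rw [flipAt_self]
      have := (hmem j).2 rfl
      rcases Int.units_eq_one_or (x j) with h2 | h2 <;>
        rcases Int.units_eq_one_or (y j) with h3 | h3 <;> simp_all
    · rw [flipAt_of_ne x hj]
      by_contra h2
      exact hj ((hmem j).1 h2)
  · rintro ⟨i, rfl⟩
    rw [Finset.sum_eq_single i (fun j _ hj => by rw [flipAt_of_ne x hj, if_pos rfl]) (by simp),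
      flipAt_self, if_neg (neg_units_ne_self (x i)).symm]

lemma integral_stepKernel_cubeGraph (hn : 1 ≤ n) (x : Cube n) (g : Cube n → ℝ) :
    ∫ z, g z ∂(stepKernel (cubeGraph n) x) = (∑ i, g (flipAt x i)) / n := by
  classical
  have hN : (cubeGraph n).neighborFinset x = Finset.univ.image (flipAt x) := by
    ext y; simp [cubeGraph_adj_iff]
  have hcard : ((cubeGraph n).neighborFinset x).card = n := by
    rw [hN, Finset.card_image_of_injective _ (flipAt_injective x)]; simp
  have hne : ((cubeGraph n).neighborFinset x).Nonempty := by
    rw [← Finset.card_pos]; omega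
  change ∫ z, g z ∂(stepPMF (cubeGraph n) x).toMeasure = _
  have hstep : stepPMF (cubeGraph n) x
      = PMF.uniformOfFinset ((cubeGraph n).neighborFinset x) hne := by
    unfold stepPMF
    rw [dif_pos (by convert hne)]
  rw [hstep, PMF.integral_eq_sum]
  simp only [PMF.uniformOfFinset_apply, hcard, smul_eq_mul]
  rw [← Finset.sum_image (f := g) (g := flipAt x) (by
    intro i _ j _ h; exact flipAt_injective x h), ← hN, Finset.sum_div]
  rw [← Finset.sum_subset (Finset.subset_univ ((cubeGraph n).neighborFinset x))]
  · refine Finset.sum_congr rfl fun y hy => ?_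
    rw [if_pos hy]
    simp [ENNReal.toReal_inv, div_eq_inv_mul]
  · intro y _ hy
    rw [if_neg hy]; simp

/-! ### Fourier analysis on the cube and the Green function -/

/-- The character `x ↦ ∏ i ∈ S, x i` of the cube. -/
noncomputable def character (S : Finset (Fin n)) (x : Cube n) : ℝ := ∏ i ∈ S, ((x i : ℤ) : ℝ)

lemma units_mul_self_real (a : ℤˣ) : ((a : ℤ) : ℝ) * ((a : ℤ) : ℝ) = 1 := by
  rcases Int.units_eq_one_or a with rfl | rfl <;> simp

lemma character_mul_self (S : Finset (Fin n)) (x : Cube n) :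
    character S x * character S x = 1 := by
  simp [character, ← Finset.prod_mul_distrib, units_mul_self_real]

lemma character_empty (x : Cube n) : character ∅ x = 1 := by simp [character]

lemma character_flipAt (S : Finset (Fin n)) (x : Cube n) (i : Fin n) :
    character S (flipAt x i) = (if i ∈ S then -1 else 1) * character S x := by
  unfold character
  split_ifs with h
  · rw [← Finset.mul_prod_erase S _ h, ← Finset.mul_prod_erase S _ h, flipAt_self,
      Finset.prod_congr rfl fun j hj => by rw [flipAt_of_ne x (Finset.ne_of_mem_erase hj)]]
    push_cast; ring
  · rw [one_mul]
    exact Finset.prod_congr rfl fun j hj => by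
      rw [flipAt_of_ne x (ne_of_mem_of_not_mem hj h)]

/-- The eigenvalue of the simple random walk at the character of `S`. -/
noncomputable def eigenvalue (S : Finset (Fin n)) : ℝ := 1 - 2 * (S.card : ℝ) / n

lemma sum_character_flipAt (hn : 1 ≤ n) (S : Finset (Fin n)) (x : Cube n) :
    (∑ i, character S (flipAt x i)) / n = eigenvalue S * character S x := by
  have hn' : (n : ℝ) ≠ 0 := by positivity
  simp only [character_flipAt, ← Finset.sum_mul, Finset.sum_ite, Finset.sum_const]
  have h1 : (Finset.univ.filter fun i => i ∈ S) = S := by ext; simp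
  have h2 : (Finset.univ.filter fun i => i ∉ S).card = n - S.card := by
    have : (Finset.univ.filter fun i => i ∉ S) = Sᶜ := by ext; simp
    rw [this, Finset.card_compl, Fintype.card_fin]
  have h3 : S.card ≤ n := by simpa using Finset.card_le_univ S
  rw [h1, h2, eigenvalue, nsmul_eq_mul, nsmul_eq_mul, Nat.cast_sub h3]
  field_simp
  ring

/-- The sum factors as `∏ i, (1 + x i * y i)`, with a zero factor wherever `x` and `y` differ. -/
lemma sum_character_mul_character (x y : Cube n) :
    ∑ S, character S x * character S y = if x = y then 2 ^ n else 0 := by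
  simp only [character, ← Finset.prod_mul_distrib]
  rw [← Finset.powerset_univ, ← Finset.prod_one_add]
  split_ifs with h
  · subst h
    simp [units_mul_self_real, one_add_one_eq_two]
  · obtain ⟨i, hi⟩ := Function.ne_iff.1 h
    refine Finset.prod_eq_zero (Finset.mem_univ i) ?_
    rcases Int.units_eq_one_or (x i) with h2 | h2 <;>
      rcases Int.units_eq_one_or (y i) with h3 | h3 <;> simp_all

lemma card_cube : Fintype.card (Cube n) = 2 ^ n := by simp

lemma sum_character_orthogonal (S T : Finset (Fin n)) :
    ∑ y, character S y * character T y = if S = T then 2 ^ n else 0 := by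
  split_ifs with h
  · subst h
    simp [character_mul_self]
  · obtain ⟨i, hi⟩ : ∃ i, ¬(i ∈ S ↔ i ∈ T) := by
      by_contra! h2
      exact h (Finset.ext h2)
    -- Flipping a coordinate in the symmetric difference of `S` and `T` reverses the sign of the
    -- summand.
    let e : Cube n ≃ Cube n :=
      Function.Involutive.toPerm (fun x => flipAt x i) (fun x => flipAt_flipAt x i)
    have h1 : ∑ y, character S y * character T y
        = ∑ y, -(character S y * character T y) := by
      rw [← Equiv.sum_comp e]
      refine Finset.sum_congr rfl fun y _ => ?_
      change character S (flipAt y i) * character T (flipAt y i) = _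
      rw [character_flipAt, character_flipAt]
      by_cases hS : i ∈ S <;> by_cases hT : i ∈ T <;> simp_all
    rw [Finset.sum_neg_distrib] at h1
    linarith

lemma eigenvalue_abs_le_one (hn : 1 ≤ n) (S : Finset (Fin n)) : |eigenvalue S| ≤ 1 := by
  have hn' : (0 : ℝ) < n := by positivity
  have h3 : (S.card : ℝ) ≤ n := by exact_mod_cast (by simpa using Finset.card_le_univ S)
  have h4 : (S.card : ℝ) / n ≤ 1 := (div_le_one hn').2 h3
  have h5 : 0 ≤ (S.card : ℝ) / n := by positivity
  rw [eigenvalue, mul_div_assoc, abs_le]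
  constructor <;> linarith

lemma one_sub_mul_eigenvalue_pos (hn : 1 ≤ n) {q : ℝ} (hq0 : 0 < q) (hq1 : q < 1)
    (S : Finset (Fin n)) : 0 < 1 - q * eigenvalue S := by
  have := (abs_le.1 (eigenvalue_abs_le_one hn S)).2
  nlinarith

/-- The spectral gap. -/
lemma inv_le_one_sub_mul_eigenvalue (hn : 1 ≤ n) {q : ℝ} (hq0 : 0 < q) (hq1 : q < 1)
    {S : Finset (Fin n)} (hS : S ≠ ∅) : (n : ℝ)⁻¹ ≤ 1 - q * eigenvalue S := by
  have hn1 : (1 : ℝ) ≤ n := by exact_mod_cast hn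
  have hinv : (n : ℝ)⁻¹ ≤ 1 := inv_le_one_of_one_le₀ hn1
  have hinv0 : 0 < (n : ℝ)⁻¹ := by positivity
  have hc : (1 : ℝ) ≤ S.card := by
    exact_mod_cast Finset.card_pos.2 (Finset.nonempty_iff_ne_empty.2 hS)
  have h1 : eigenvalue S ≤ 1 - 2 * (n : ℝ)⁻¹ := by
    rw [eigenvalue, div_eq_mul_inv]
    nlinarith
  -- For a nonpositive eigenvalue the right side is at least `1`; for a positive one, `q < 1` leaves
  -- at least `2 / n`.
  rcases le_or_gt (eigenvalue S) 0 with h | h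
  · nlinarith
  · nlinarith

/-- The Green function `∑ k, q ^ k * p_k(x, y)` of the walk killed at rate `1 - q`. -/
noncomputable def green (q : ℝ) (x y : Cube n) : ℝ :=
  (2 ^ n)⁻¹ * ∑ S, character S x * character S y / (1 - q * eigenvalue S)

/-- The difference between the Green function and the contribution of the uniform law. -/
noncomputable def greenDev (q : ℝ) (x y : Cube n) : ℝ :=
  (2 ^ n)⁻¹ * ∑ S ∈ Finset.univ.erase ∅, character S x * character S y / (1 - q * eigenvalue S)

lemma green_eq_add_greenDev (q : ℝ) (x y : Cube n) :
    green q x y = (2 ^ n)⁻¹ / (1 - q) + greenDev q x y := by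
  rw [green, greenDev, ← Finset.add_sum_erase _ _ (Finset.mem_univ ∅), mul_add]
  simp [character_empty, eigenvalue, div_eq_mul_inv]

lemma green_eq_step (hn : 1 ≤ n) {q : ℝ} (hq0 : 0 < q) (hq1 : q < 1) (x y : Cube n) :
    green q x y = q * ((∑ i, green q (flipAt x i) y) / n) + if x = y then 1 else 0 := by
  have h1 : (∑ i, green q (flipAt x i) y) / n
      = (2 ^ n)⁻¹ * ∑ S, eigenvalue S
          * (character S x * character S y / (1 - q * eigenvalue S)) := by
    simp only [green]
    rw [← Finset.mul_sum, Finset.sum_comm, mul_div_assoc, Finset.sum_div]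
    congr 1
    refine Finset.sum_congr rfl fun S _ => ?_
    rw [← Finset.sum_div, ← Finset.sum_mul, div_right_comm, mul_div_right_comm,
      sum_character_flipAt hn]
    ring
  have h2 : (if x = y then (1 : ℝ) else 0) = (2 ^ n)⁻¹ * ∑ S, character S x * character S y := by
    rw [sum_character_mul_character]
    split_ifs <;> simp
  rw [h1, h2, green, mul_left_comm, ← mul_add, Finset.mul_sum _ _ q, ← Finset.sum_add_distrib]
  congr 1
  refine Finset.sum_congr rfl fun S _ => ?_
  have := (one_sub_mul_eigenvalue_pos hn hq0 hq1 S).ne'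
  field_simp
  ring

/-- Parseval: the spectral gap bounds each of the fewer than `2 ^ n` nonconstant coefficients by `n`
in absolute value, before the normalisation `2⁻ⁿ`. -/
lemma sum_greenDev_sq_le (hn : 1 ≤ n) {q : ℝ} (hq0 : 0 < q) (hq1 : q < 1) (x : Cube n) :
    ∑ y, greenDev q x y ^ 2 ≤ (n : ℝ) ^ 2 := by
  have hn' : (0 : ℝ) < n := by positivity
  set E : Finset (Finset (Fin n)) := Finset.univ.erase ∅
  set a : Finset (Fin n) → ℝ := fun S => character S x / (1 - q * eigenvalue S) with ha
  have h1 : ∑ y, greenDev q x y ^ 2 = (2 ^ n)⁻¹ * ∑ S ∈ E, a S ^ 2 := by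
    have h2 : ∀ y : Cube n, greenDev q x y ^ 2
        = (2 ^ n)⁻¹ ^ 2 * ∑ S ∈ E, ∑ T ∈ E, a S * a T * (character S y * character T y) :=
        fun y => by
      rw [greenDev, mul_pow, pow_two (∑ S ∈ E, _), Finset.sum_mul_sum]
      congr 1
      refine Finset.sum_congr rfl fun S _ => Finset.sum_congr rfl fun T _ => ?_
      simp only [ha]; ring
    simp only [h2]
    rw [← Finset.mul_sum, Finset.sum_comm]
    have h3 : ∀ S ∈ E, ∑ y : Cube n, ∑ T ∈ E, a S * a T * (character S y * character T y)
        = 2 ^ n * a S ^ 2 := fun S hS => by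
      rw [Finset.sum_comm]
      simp only [← Finset.mul_sum, sum_character_orthogonal, mul_ite, mul_zero]
      rw [Finset.sum_ite_eq, if_pos hS]
      ring
    rw [Finset.sum_congr rfl h3, ← Finset.mul_sum]
    field_simp
  have h4 : ∀ S ∈ E, a S ^ 2 ≤ (n : ℝ) ^ 2 := fun S hS => by
    have hg := inv_le_one_sub_mul_eigenvalue hn hq0 hq1 (Finset.ne_of_mem_erase hS)
    have hpos := one_sub_mul_eigenvalue_pos hn hq0 hq1 S
    rw [ha]
    simp only
    rw [div_pow, pow_two (character S x), character_mul_self, ← one_div_pow]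
    gcongr
    rw [one_div]
    exact inv_le_of_inv_le₀ hn' hg
  rw [h1]
  have h5 : ∑ S ∈ E, a S ^ 2 ≤ 2 ^ n * (n : ℝ) ^ 2 := by
    refine (Finset.sum_le_sum h4).trans ?_
    rw [Finset.sum_const, nsmul_eq_mul]
    gcongr
    have : E.card ≤ 2 ^ n := (Finset.card_le_univ E).trans (by simp)
    exact_mod_cast this
  calc (2 ^ n)⁻¹ * ∑ S ∈ E, a S ^ 2 ≤ (2 ^ n)⁻¹ * (2 ^ n * (n : ℝ) ^ 2) := by gcongr
    _ = _ := by field_simp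

lemma sum_abs_greenDev_le (hn : 1 ≤ n) {q : ℝ} (hq0 : 0 < q) (hq1 : q < 1) (x : Cube n) :
    ∑ y, |greenDev q x y| ≤ n * √(2 ^ n) := by
  have h := sq_sum_le_card_mul_sum_sq (s := Finset.univ) (f := fun y : Cube n => |greenDev q x y|)
  simp only [sq_abs, Finset.card_univ, card_cube] at h
  refine le_of_sq_le_sq ?_ (by positivity)
  rw [mul_pow, Real.sq_sqrt (by positivity)]
  refine h.trans ?_
  push_cast
  rw [mul_comm]
  gcongr
  exact sum_greenDev_sq_le hn hq0 hq1 x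

/-- For a uniform random subset, `|T| - 2 |S|` is a sum of `|T|` independent signs; these are its
first four moments, by adding one sign at a time. -/
lemma sum_powerset_pow_card_sub {ι : Type*} (T : Finset ι) :
    ∑ S ∈ T.powerset, ((T.card : ℝ) - 2 * S.card) = 0 ∧
    ∑ S ∈ T.powerset, ((T.card : ℝ) - 2 * S.card) ^ 2 = (2 : ℝ) ^ T.card * T.card ∧
    ∑ S ∈ T.powerset, ((T.card : ℝ) - 2 * S.card) ^ 3 = 0 ∧
    ∑ S ∈ T.powerset, ((T.card : ℝ) - 2 * S.card) ^ 4
      = (2 : ℝ) ^ T.card * (3 * (T.card : ℝ) ^ 2 - 2 * T.card) := by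
  classical
  induction T using Finset.induction_on with
  | empty => simp
  | insert a T ha ih =>
    obtain ⟨h1, h2, h3, h4⟩ := ih
    have hsum : ∀ F : ℝ → ℝ, ∑ S ∈ (insert a T).powerset, F (((insert a T).card : ℝ) - 2 * S.card)
        = ∑ S ∈ T.powerset, (F (((T.card : ℝ) - 2 * S.card) + 1)
            + F (((T.card : ℝ) - 2 * S.card) - 1)) := fun F => by
      rw [Finset.sum_powerset_insert ha, ← Finset.sum_add_distrib]
      refine Finset.sum_congr rfl fun S hS => ?_
      have haS : a ∉ S := fun h => ha (Finset.mem_powerset.1 hS h)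
      rw [Finset.card_insert_of_notMem ha, Finset.card_insert_of_notMem haS]
      push_cast
      congr 2 <;> ring
    have h0 : ∑ S ∈ T.powerset, (1 : ℝ) = 2 ^ T.card := by simp
    refine ⟨?_, ?_, ?_, ?_⟩
    · rw [hsum (fun t => t)]
      calc _ = 2 * ∑ S ∈ T.powerset, ((T.card : ℝ) - 2 * S.card) := by
            rw [Finset.mul_sum]; exact Finset.sum_congr rfl fun _ _ => by ring
        _ = 0 := by rw [h1]; simp
    · rw [hsum (fun t => t ^ 2)]
      calc _ = 2 * ∑ S ∈ T.powerset, ((T.card : ℝ) - 2 * S.card) ^ 2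
              + 2 * ∑ S ∈ T.powerset, (1 : ℝ) := by
            rw [Finset.mul_sum, Finset.mul_sum, ← Finset.sum_add_distrib]
            exact Finset.sum_congr rfl fun _ _ => by ring
        _ = _ := by
            rw [h2, h0, Finset.card_insert_of_notMem ha]; push_cast; ring
    · rw [hsum (fun t => t ^ 3)]
      calc _ = 2 * ∑ S ∈ T.powerset, ((T.card : ℝ) - 2 * S.card) ^ 3
              + 6 * ∑ S ∈ T.powerset, ((T.card : ℝ) - 2 * S.card) := by
            rw [Finset.mul_sum, Finset.mul_sum, ← Finset.sum_add_distrib]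
            exact Finset.sum_congr rfl fun _ _ => by ring
        _ = 0 := by rw [h1, h3]; simp
    · rw [hsum (fun t => t ^ 4)]
      calc _ = 2 * ∑ S ∈ T.powerset, ((T.card : ℝ) - 2 * S.card) ^ 4
              + 12 * ∑ S ∈ T.powerset, ((T.card : ℝ) - 2 * S.card) ^ 2
              + 2 * ∑ S ∈ T.powerset, (1 : ℝ) := by
            rw [Finset.mul_sum, Finset.mul_sum, Finset.mul_sum, ← Finset.sum_add_distrib,
              ← Finset.sum_add_distrib]
            exact Finset.sum_congr rfl fun _ _ => by ring
        _ = _ := by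
            rw [h2, h4, h0, Finset.card_insert_of_notMem ha]; push_cast; ring

lemma sum_eigenvalue_pow (hn : 1 ≤ n) :
    ∑ S : Finset (Fin n), eigenvalue S = 0 ∧
    ∑ S : Finset (Fin n), eigenvalue S ^ 2 = 2 ^ n / n ∧
    ∑ S : Finset (Fin n), eigenvalue S ^ 3 = 0 ∧
    ∑ S : Finset (Fin n), eigenvalue S ^ 4 ≤ 2 ^ n * (3 / (n : ℝ) ^ 2) := by
  have hn' : (0 : ℝ) < n := by positivity
  obtain ⟨h1, h2, h3, h4⟩ := sum_powerset_pow_card_sub (Finset.univ : Finset (Fin n))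
  simp only [Finset.powerset_univ, Finset.card_univ, Fintype.card_fin] at h1 h2 h3 h4
  have he : ∀ S : Finset (Fin n), eigenvalue S = ((n : ℝ) - 2 * S.card) / n := fun S => by
    rw [eigenvalue]; field_simp
  simp only [he, div_pow, ← Finset.sum_div, h1, h2, h3, h4]
  refine ⟨by simp, by field_simp, by simp, ?_⟩
  rw [mul_div_assoc]
  refine mul_le_mul_of_nonneg_left ?_ (by positivity)
  rw [div_le_div_iff₀ (by positivity) (by positivity)]
  nlinarith [pow_pos hn' 3]

/-- The Green function on the diagonal is `1 + O(1 / n)` apart from the uniform part. -/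
lemma abs_greenDev_self_sub_one_le (hn : 1 ≤ n) {q : ℝ} (hq0 : 0 < q) (hq1 : q < 1)
    (x : Cube n) : |greenDev q x x - 1| ≤ 4 / n := by
  have hn' : (0 : ℝ) < n := by positivity
  obtain ⟨h1, h2, h3, h4⟩ := sum_eigenvalue_pow hn
  set E : Finset (Finset (Fin n)) := Finset.univ.erase ∅
  -- With `u = q * eigenvalue S`, `1 / (1 - u) = P S + u ^ 4 / (1 - u)`. The remainder is
  -- nonnegative and, by the gap, at most `n * eigenvalue S ^ 4`. Order three is what is needed: the
  -- fourth moment `3 / n²` beats the factor `n`.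
  set P : Finset (Fin n) → ℝ := fun S => 1 + q * eigenvalue S + (q * eigenvalue S) ^ 2
    + (q * eigenvalue S) ^ 3 with hP
  have hD : greenDev q x x = (2 ^ n)⁻¹ * ∑ S ∈ E, 1 / (1 - q * eigenvalue S) := by
    simp only [greenDev, character_mul_self]; rfl
  have hsum : ∑ S, P S = 2 ^ n * (1 + q ^ 2 / n) := by
    simp only [hP, Finset.sum_add_distrib, mul_pow, ← Finset.mul_sum, h1, h2, h3]
    simp; ring
  have hE : ∑ S ∈ E, P S = 2 ^ n * (1 + q ^ 2 / n) - P ∅ := by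
    rw [← hsum, ← Finset.add_sum_erase _ _ (Finset.mem_univ ∅)]; ring
  have hP0 : 0 ≤ P ∅ ∧ P ∅ ≤ 4 := by
    have : (eigenvalue (∅ : Finset (Fin n))) = 1 := by simp [eigenvalue]
    simp only [hP, this, mul_one]
    refine ⟨by positivity, ?_⟩
    have := pow_le_one₀ (n := 2) hq0.le hq1.le
    have := pow_le_one₀ (n := 3) hq0.le hq1.le
    linarith
  have hlo : ∀ S ∈ E, P S ≤ 1 / (1 - q * eigenvalue S) := fun S _ => by
    have hpos := one_sub_mul_eigenvalue_pos hn hq0 hq1 S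
    rw [le_div_iff₀ hpos]
    have : 0 ≤ (q * eigenvalue S) ^ 4 := by positivity
    simp only [hP]
    nlinarith
  have hup : ∀ S ∈ E, 1 / (1 - q * eigenvalue S) ≤ P S + n * eigenvalue S ^ 4 := fun S hS => by
    have hpos := one_sub_mul_eigenvalue_pos hn hq0 hq1 S
    have hg := inv_le_one_sub_mul_eigenvalue hn hq0 hq1 (Finset.ne_of_mem_erase hS)
    have hg' : 1 ≤ n * (1 - q * eigenvalue S) := by
      rwa [inv_le_iff_one_le_mul₀ hn', mul_comm] at hg
    rw [div_le_iff₀ hpos]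
    have hq4 : (q * eigenvalue S) ^ 4 ≤ eigenvalue S ^ 4 := by
      rw [mul_pow]
      exact mul_le_of_le_one_left (by positivity) (pow_le_one₀ hq0.le hq1.le)
    have h6 : eigenvalue S ^ 4 * 1 ≤ eigenvalue S ^ 4 * (n * (1 - q * eigenvalue S)) := by
      gcongr
    have h7 : (P S + n * eigenvalue S ^ 4) * (1 - q * eigenvalue S)
        = 1 - (q * eigenvalue S) ^ 4 + eigenvalue S ^ 4 * (n * (1 - q * eigenvalue S)) := by
      simp only [hP]; ring
    rw [h7]; linarith
  have hLO := Finset.sum_le_sum hlo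
  have hUP := Finset.sum_le_sum hup
  rw [hE] at hLO
  rw [Finset.sum_add_distrib, hE, ← Finset.mul_sum] at hUP
  have h8 : ∑ S ∈ E, eigenvalue S ^ 4 ≤ 2 ^ n * (3 / (n : ℝ) ^ 2) :=
    (Finset.sum_le_sum_of_subset_of_nonneg (Finset.subset_univ E)
      fun _ _ _ => by positivity).trans h4
  have h2n : (0 : ℝ) < 2 ^ n := by positivity
  have hn2 : (n : ℝ) ≤ 2 ^ n := by exact_mod_cast Nat.lt_two_pow_self.le
  rw [abs_le, hD]
  set X := ∑ S ∈ E, 1 / (1 - q * eigenvalue S)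
  constructor
  -- The only loss below is the omitted term `P ∅ ≤ 4`.
  · have h9 : 4 / (2 : ℝ) ^ n ≤ 4 / n := by gcongr
    have h10 : (2 ^ n : ℝ) - 4 ≤ X := by
      have : 0 ≤ (2 : ℝ) ^ n * (q ^ 2 / n) := by positivity
      nlinarith [hP0.2]
    have : (2 ^ n : ℝ)⁻¹ * (2 ^ n - 4) ≤ (2 ^ n)⁻¹ * X := by gcongr
    have h11 : (2 ^ n : ℝ)⁻¹ * (2 ^ n - 4) = 1 - 4 / 2 ^ n := by field_simp
    linarith
  · have hqn : q ^ 2 / n ≤ 1 / n := by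
      gcongr; exact pow_le_one₀ hq0.le hq1.le
    -- Here `1 / n` comes from the second moment and `3 / n` from the remainder.
    have h12 : X ≤ 2 ^ n * (1 + 1 / n + 3 / n) := by
      have : n * ∑ S ∈ E, eigenvalue S ^ 4 ≤ n * (2 ^ n * (3 / (n : ℝ) ^ 2)) := by gcongr
      have h13 : n * (2 ^ n * (3 / (n : ℝ) ^ 2)) = 2 ^ n * (3 / n) := by field_simp
      have h14 : (2 : ℝ) ^ n * (q ^ 2 / n) ≤ 2 ^ n * (1 / n) := by gcongr
      nlinarith [hP0.1]
    have : (2 ^ n : ℝ)⁻¹ * X ≤ (2 ^ n)⁻¹ * (2 ^ n * (1 + 1 / n + 3 / n)) := by gcongr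
    have h15 : (2 ^ n : ℝ)⁻¹ * (2 ^ n * (1 + 1 / n + 3 / n)) = 1 + 4 / n := by
      field_simp; ring
    linarith

end CubeLemmas

/-! ### The Laplace transform for a fixed set of targets -/

section DeterministicBound

variable {n : ℕ}

open Classical in
/-- The total deviation of the Green function over pairs `x ≠ y` with `x ∈ A ∪ {o}`, `y ∈ A`. -/
noncomputable def pairDev (q : ℝ) (A : Set (Cube n)) (o : Cube n) : ℝ :=
  ∑ x, ∑ y, if (x ∈ A ∨ x = o) ∧ y ∈ A ∧ y ≠ x then |greenDev q x y| else 0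

lemma pairDev_nonneg (q : ℝ) (A : Set (Cube n)) (o : Cube n) : 0 ≤ pairDev q A o :=
  Finset.sum_nonneg fun _ _ => Finset.sum_nonneg fun _ _ => by split_ifs <;> positivity

lemma abs_sum_greenDev_le_pairDev {q : ℝ} {A : Set (Cube n)} {o x : Cube n}
    (hx : x ∈ A ∨ x = o) {B : Finset (Cube n)} (hB : ∀ y ∈ B, y ∈ A ∧ y ≠ x) :
    |∑ y ∈ B, greenDev q x y| ≤ pairDev q A o := by
  classical
  calc |∑ y ∈ B, greenDev q x y| ≤ ∑ y ∈ B, |greenDev q x y| := Finset.abs_sum_le_sum_abs _ _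
    _ = ∑ y ∈ B, if (x ∈ A ∨ x = o) ∧ y ∈ A ∧ y ≠ x then |greenDev q x y| else 0 :=
      Finset.sum_congr rfl fun y hy => by rw [if_pos ⟨hx, hB y hy⟩]
    _ ≤ ∑ y, if (x ∈ A ∨ x = o) ∧ y ∈ A ∧ y ≠ x then |greenDev q x y| else 0 :=
      Finset.sum_le_sum_of_subset_of_nonneg (Finset.subset_univ B) fun _ _ _ => by
        split_ifs <;> positivity
    _ ≤ pairDev q A o := by
      unfold pairDev
      convert Finset.single_le_sum (s := Finset.univ) (f := fun x => ∑ y,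
        if (x ∈ A ∨ x = o) ∧ y ∈ A ∧ y ≠ x then |greenDev q x y| else 0)
        (fun x _ => Finset.sum_nonneg fun _ _ => by split_ifs <;> positivity) (Finset.mem_univ x)

lemma abs_div_one_add_sub_le {a b : ℝ} (ha : 0 ≤ a) (hb : 0 ≤ b) :
    |a / (1 + a) - b / (1 + b)| ≤ |a - b| := by
  have h : a / (1 + a) - b / (1 + b) = (a - b) / ((1 + a) * (1 + b)) := by
    field_simp; ring
  rw [h, abs_div, abs_of_nonneg (a := (1 + a) * (1 + b)) (by positivity)]
  exact div_le_self (abs_nonneg _) (by nlinarith [mul_nonneg ha hb])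

/-- The errors are the diagonal deviation `4 / n`, the off-diagonal deviations once on the target
set and once at `x`, and one term for replacing the size of `A \ {x}` by that of `A`. -/
theorem abs_hittingLaplace_cube_sub_le (hn : 1 ≤ n) {c : ℝ} (hc : 0 < c) (A : Set (Cube n))
    {o x : Cube n} (hx : x ∈ A ∪ {o}) :
    |hittingLaplace (cubeGraph n) x (A \ {x}) c
      - A.ncard * ((2 ^ n)⁻¹ / (1 - Real.exp (-c)))
        / (1 + A.ncard * ((2 ^ n)⁻¹ / (1 - Real.exp (-c))))|
      ≤ 4 / n + 2 * pairDev (Real.exp (-c)) A o + (2 ^ n)⁻¹ / (1 - Real.exp (-c)) := by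
  classical
  set q := Real.exp (-c) with hq
  have hq0 : 0 < q := Real.exp_pos _
  have hq1 : q < 1 := Real.exp_lt_one_iff.2 (by linarith)
  set w : ℝ := (2 ^ n)⁻¹ / (1 - q) with hw
  have hw0 : 0 ≤ w := div_nonneg (by positivity) (by linarith)
  set W := pairDev q A o
  have hW0 : 0 ≤ W := pairDev_nonneg q A o
  set B : Finset (Cube n) := (A \ {x}).toFinset with hB
  have hmem : ∀ y, y ∈ B ↔ y ∈ A ∧ y ≠ x := fun y => by simp [hB]
  set b : ℝ := (B.card : ℝ) with hb
  have hb0 : 0 ≤ b := by positivity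
  set v : Cube n → ℝ := fun y => ∑ z ∈ B, green q y z with hv
  have hvy : ∀ y, v y = b * w + ∑ z ∈ B, greenDev q y z := fun y => by
    simp only [hv, green_eq_add_greenDev, Finset.sum_add_distrib, Finset.sum_const, nsmul_eq_mul]
    rfl
  have hn4 : (0 : ℝ) ≤ 4 / n := by positivity
  -- On the target set the diagonal term supplies the `1` in `C = 1 + b * w`; at `x`, which is not a
  -- target, it is absent.
  have hmain := abs_sub_mul_hittingLaplace_le (cubeGraph n) x (B := A \ {x}) hc (v := v)
    (C := 1 + b * w) (ε := 4 / n + W) (by positivity) (by positivity) (fun y hy => by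
      have hyB : y ∉ B := fun h => hy (by simpa [hB] using h)
      rw [integral_stepKernel_cubeGraph hn]
      simp only [hv]
      rw [Finset.sum_comm, Finset.sum_div, Finset.mul_sum]
      refine Finset.sum_congr rfl fun z hz => ?_
      rw [green_eq_step hn hq0 hq1, if_neg (ne_of_mem_of_not_mem hz hyB).symm, add_zero])
    (fun y hy => by
      have hyB : y ∈ B := by simpa [hB] using hy
      rw [hvy, ← Finset.add_sum_erase _ _ hyB]
      have h1 := abs_greenDev_self_sub_one_le hn hq0 hq1 y
      have h2 : |∑ z ∈ B.erase y, greenDev q y z| ≤ W :=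
        abs_sum_greenDev_le_pairDev (Or.inl hy.1) fun z hz =>
          ⟨((hmem z).1 (Finset.mem_of_mem_erase hz)).1, Finset.ne_of_mem_erase hz⟩
      have h3 : b * w + (greenDev q y y + ∑ z ∈ B.erase y, greenDev q y z) - (1 + b * w)
          = (greenDev q y y - 1) + ∑ z ∈ B.erase y, greenDev q y z := by ring
      rw [h3]
      exact (abs_add_le _ _).trans (add_le_add h1 h2))
  set L := hittingLaplace (cubeGraph n) x (A \ {x}) c
  have hvx : |v x - b * w| ≤ W := by
    rw [hvy, add_sub_cancel_left]
    exact abs_sum_greenDev_le_pairDev (by simpa [or_comm] using hx) fun y hy => (hmem y).1 hy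
  have hbw : 0 ≤ b * w := by positivity
  have h1 : |L - b * w / (1 + b * w)| ≤ 4 / n + 2 * W := by
    have h2 : L - b * w / (1 + b * w) = ((1 + b * w) * L - b * w) / (1 + b * w) := by
      field_simp
    rw [h2, abs_div, abs_of_nonneg (a := 1 + b * w) (by positivity)]
    refine (div_le_self (abs_nonneg _) (by linarith)).trans ?_
    have h3 : (1 + b * w) * L - b * w = (v x - b * w) - (v x - (1 + b * w) * L) := by ring
    rw [h3]
    exact (abs_sub _ _).trans (by linarith)
  have hcard : |b * w - A.ncard * w| ≤ w := by
    rw [← sub_mul, abs_mul, abs_of_nonneg hw0]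
    refine mul_le_of_le_one_left hw0 ?_
    have hbn : B.card = (A \ {x}).ncard := by rw [hB, Set.ncard_eq_toFinset_card']
    have h4 : (A \ {x}).ncard ≤ A.ncard := Set.ncard_sdiff_singleton_le A x
    have h5 : A.ncard ≤ (A \ {x}).ncard + 1 :=
      Nat.le_add_of_sub_le (Set.pred_ncard_le_ncard_sdiff_singleton A x)
    rw [hb, hbn, abs_le]
    have h4' : ((A \ {x}).ncard : ℝ) ≤ A.ncard := by exact_mod_cast h4
    have h5' : (A.ncard : ℝ) ≤ (A \ {x}).ncard + 1 := by exact_mod_cast h5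
    constructor <;> linarith
  have h6 := abs_div_one_add_sub_le hbw (show 0 ≤ (A.ncard : ℝ) * w by positivity)
  calc _ ≤ |L - b * w / (1 + b * w)| + |b * w / (1 + b * w) - A.ncard * w / (1 + A.ncard * w)| :=
        abs_sub_le _ _ _
    _ ≤ _ := by linarith

end DeterministicBound

/-! ### Moment bounds for Poisson clouds -/

section CloudLemmas

/-- Nonnegative variables with summable expectations tend to zero almost surely. -/
lemma ae_tendsto_zero_of_summable_integral {Ω : Type*} [MeasurableSpace Ω] {P : Measure Ω}
    {X : ℕ → Ω → ℝ} {b : ℕ → ℝ} (hX : ∀ n ω, 0 ≤ X n ω)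
    (h : ∀ᶠ n in atTop, Integrable (X n) P ∧ ∫ ω, X n ω ∂P ≤ b n) (hb : Summable b) :
    ∀ᵐ ω ∂P, Tendsto (fun n => X n ω) atTop (𝓝 0) := by
  obtain ⟨N, hN⟩ := eventually_atTop.1 h
  have hi : ∀ n, Integrable (X (n + N)) P := fun n => (hN _ (Nat.le_add_left _ _)).1
  have hb' : Summable fun n => b (n + N) := (summable_nat_add_iff N).2 hb
  have hle : ∀ n, ∫ ω, X (n + N) ω ∂P ≤ b (n + N) := fun n => (hN _ (Nat.le_add_left _ _)).2
  have hb0 : ∀ n, 0 ≤ b (n + N) := fun n => (integral_nonneg (hX _)).trans (hle n)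
  have hfin : ∫⁻ ω, ∑' n, ENNReal.ofReal (X (n + N) ω) ∂P ≠ ⊤ := by
    rw [lintegral_tsum fun n => (hi n).aestronglyMeasurable.aemeasurable.ennreal_ofReal]
    refine ne_top_of_le_ne_top hb'.tsum_ofReal_ne_top (ENNReal.tsum_le_tsum fun n => ?_)
    rw [← ofReal_integral_eq_lintegral_ofReal (hi n) (Eventually.of_forall (hX _))]
    exact ENNReal.ofReal_le_ofReal (hle n)
  filter_upwards [ae_lt_top' (AEMeasurable.tsum fun n =>
    (hi n).aestronglyMeasurable.aemeasurable.ennreal_ofReal) hfin] with ω hω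
  have h0 := ENNReal.tendsto_atTop_zero_of_tsum_ne_top hω.ne
  rw [← tendsto_add_atTop_iff_nat N]
  have h1 := (ENNReal.tendsto_toReal ENNReal.zero_ne_top).comp h0
  refine h1.congr fun n => ?_
  simp [ENNReal.toReal_ofReal (hX (n + N) ω)]

variable {V Ω : Type*} [MeasurableSpace Ω] {P : Measure Ω} {A : Ω → Set V} {p : ℝ}

lemma IsPoissonCloud.measureReal_mem (h : IsPoissonCloud P A p) (x : V) :
    P.real {ω | x ∈ A ω} = p := by
  rw [Measure.real, h.prob_mem, ENNReal.toReal_ofReal h.pos.le]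

lemma IsPoissonCloud.measureReal_mem_inter (h : IsPoissonCloud P A p) {x y : V} (hxy : x ≠ y) :
    P.real ({ω | x ∈ A ω} ∩ {ω | y ∈ A ω}) = p ^ 2 := by
  classical
  have := h.indep.meas_biInter {x, y}
  simp only [Finset.set_biInter_insert, Finset.set_biInter_singleton, Finset.prod_pair hxy] at this
  rw [Measure.real, this, ENNReal.toReal_mul, h.prob_mem, h.prob_mem,
    ENNReal.toReal_ofReal h.pos.le, pow_two]

variable [IsProbabilityMeasure P]

/-- The centred indicator of the event that `x` belongs to the cloud. -/
noncomputable def centredIndicator (A : Ω → Set V) (p : ℝ) (x : V) (ω : Ω) : ℝ :=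
  {ω | x ∈ A ω}.indicator (fun _ => 1) ω - p

lemma IsPoissonCloud.integrable_centredIndicator_mul (h : IsPoissonCloud P A p) (x y : V) :
    Integrable (fun ω => centredIndicator A p x ω * centredIndicator A p y ω) P := by
  have hm : ∀ z, Measurable (centredIndicator A p z) := fun z =>
    (measurable_const.indicator (h.measurableSet_mem z)).sub_const p
  have hb : ∀ z ω, |centredIndicator A p z ω| ≤ 1 := fun z ω => by
    have := h.pos
    have := h.lt_one
    unfold centredIndicator
    by_cases hz : ω ∈ {ω | z ∈ A ω}
    · rw [Set.indicator_of_mem hz, abs_le]; constructor <;> linarith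
    · rw [Set.indicator_of_notMem hz, abs_le]; constructor <;> linarith
  refine Integrable.of_bound ((hm x).mul (hm y)).aestronglyMeasurable 1
    (Eventually.of_forall fun ω => ?_)
  rw [Real.norm_eq_abs, abs_mul]
  exact mul_le_one₀ (hb x ω) (abs_nonneg _) (hb y ω)

lemma IsPoissonCloud.integral_centredIndicator_mul_le (h : IsPoissonCloud P A p) [DecidableEq V]
    (x y : V) : ∫ ω, centredIndicator A p x ω * centredIndicator A p y ω ∂P
      ≤ if x = y then p else 0 := by
  have hi : ∀ z, Integrable ({ω | z ∈ A ω}.indicator fun _ => (1 : ℝ)) P := fun z =>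
    (integrable_const 1).indicator (h.measurableSet_mem z)
  have hI : ∀ z, ∫ ω, {ω | z ∈ A ω}.indicator (fun _ => (1 : ℝ)) ω ∂P = p := fun z => by
    rw [integral_indicator_const _ (h.measurableSet_mem z), h.measureReal_mem]; simp
  have hm2 := (h.measurableSet_mem x).inter (h.measurableSet_mem y)
  have h2 : ∫ ω, centredIndicator A p x ω * centredIndicator A p y ω ∂P
      = P.real ({ω | x ∈ A ω} ∩ {ω | y ∈ A ω}) - p ^ 2 := by
    have he : ∀ ω, centredIndicator A p x ω * centredIndicator A p y ω
        = (({ω | x ∈ A ω} ∩ {ω | y ∈ A ω}).indicator (fun _ => (1 : ℝ)) ω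
          - p * {ω | x ∈ A ω}.indicator (fun _ => (1 : ℝ)) ω)
          - p * {ω | y ∈ A ω}.indicator (fun _ => (1 : ℝ)) ω + p ^ 2 := fun ω => by
      unfold centredIndicator
      by_cases hx : x ∈ A ω <;> by_cases hy : y ∈ A ω <;> simp [Set.indicator, hx, hy] <;> ring
    simp only [he]
    have i0 := (integrable_const (μ := P) (1 : ℝ)).indicator hm2
    rw [integral_add (by exact (i0.sub ((hi x).const_mul p)).sub ((hi y).const_mul p))
        (integrable_const _),
      integral_sub (by exact i0.sub ((hi x).const_mul p)) ((hi y).const_mul p),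
      integral_sub i0 ((hi x).const_mul p), integral_const_mul, integral_const_mul, hI, hI,
      integral_indicator_const _ hm2]
    simp; ring
  rw [h2]
  split_ifs with hxy
  · subst hxy
    rw [Set.inter_self, h.measureReal_mem]
    nlinarith [sq_nonneg p]
  · rw [h.measureReal_mem_inter hxy, sub_self]

lemma ncard_sub_eq_sum_centredIndicator {V Ω : Type*} [Fintype V] (A : Ω → Set V) (p : ℝ) (ω : Ω) :
    ((A ω).ncard : ℝ) - Fintype.card V * p = ∑ x, centredIndicator A p x ω := by
  classical
  simp only [centredIndicator, Finset.sum_sub_distrib, Finset.sum_const, nsmul_eq_mul,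
    Finset.card_univ]
  congr 1
  rw [Set.ncard_eq_toFinset_card']
  simp only [Set.indicator, Set.mem_ofPred_eq, Finset.sum_boole]
  congr 2
  ext x
  simp

/-- Second moment bound for the number of points of a Poisson cloud. -/
lemma IsPoissonCloud.integral_ncard_sub_sq_le [Fintype V] (h : IsPoissonCloud P A p) :
    Integrable (fun ω => (((A ω).ncard : ℝ) - Fintype.card V * p) ^ 2) P ∧
    ∫ ω, (((A ω).ncard : ℝ) - Fintype.card V * p) ^ 2 ∂P ≤ Fintype.card V * p := by
  classical
  have he : ∀ ω, (((A ω).ncard : ℝ) - Fintype.card V * p) ^ 2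
      = ∑ x, ∑ y, centredIndicator A p x ω * centredIndicator A p y ω := fun ω => by
    rw [ncard_sub_eq_sum_centredIndicator, pow_two, Finset.sum_mul_sum]
  simp only [he]
  have hi := h.integrable_centredIndicator_mul
  have hi' : ∀ x, Integrable
      (fun ω => ∑ y, centredIndicator A p x ω * centredIndicator A p y ω) P := fun x => integrable_finsetSum _ fun y _ => hi x y
  refine ⟨integrable_finsetSum _ fun x _ => hi' x, ?_⟩
  rw [integral_finsetSum _ fun x _ => hi' x]
  calc _ = ∑ x, ∑ y, ∫ ω, centredIndicator A p x ω * centredIndicator A p y ω ∂P :=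
        Finset.sum_congr rfl fun x _ => integral_finsetSum _ fun y _ => hi x y
    _ ≤ ∑ x : V, ∑ y : V, if x = y then p else 0 :=
        Finset.sum_le_sum fun x _ => Finset.sum_le_sum fun y _ =>
          h.integral_centredIndicator_mul_le x y
    _ = _ := by simp

/-- First moment bound for the deviation of the Green function over pairs of cloud points. -/
lemma IsPoissonCloud.integral_pairDev_le {n : ℕ} {A : Ω → Set (Cube n)}
    (h : IsPoissonCloud P A p) (hn : 1 ≤ n) {q : ℝ} (hq0 : 0 < q) (hq1 : q < 1) (o : Cube n) :
    Integrable (fun ω => pairDev q (A ω) o) P ∧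
    ∫ ω, pairDev q (A ω) o ∂P ≤ (2 ^ n * p ^ 2 + p) * (n * √(2 ^ n)) := by
  classical
  set T : Cube n → Cube n → Set Ω := fun x y =>
    {ω | (x ∈ A ω ∨ x = o) ∧ y ∈ A ω ∧ y ≠ x} with hT
  have hTm : ∀ x y, MeasurableSet (T x y) := fun x y =>
    ((h.measurableSet_mem x).union (MeasurableSet.const _)).inter
      ((h.measurableSet_mem y).inter (MeasurableSet.const _))
  have he : ∀ ω, pairDev q (A ω) o
      = ∑ x, ∑ y, (T x y).indicator (fun _ => |greenDev q x y|) ω := fun ω => by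
    unfold pairDev
    refine Finset.sum_congr rfl fun x _ => Finset.sum_congr rfl fun y _ => ?_
    simp only [Set.indicator, hT, Set.mem_ofPred_eq]
  have hi : ∀ x y, Integrable ((T x y).indicator fun _ => |greenDev q x y|) P := fun x y =>
    (integrable_const _).indicator (hTm x y)
  have hi' : ∀ x, Integrable (fun ω => ∑ y, (T x y).indicator (fun _ => |greenDev q x y|) ω) P :=
    fun x => integrable_finsetSum _ fun y _ => hi x y
  have hp := h.pos
  -- The start `o` need not lie in the cloud, so for it only `y ∈ A` costs a factor `p`.
  have hprob : ∀ x y, P.real (T x y) ≤ p ^ 2 + if x = o then p else 0 := fun x y => by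
    have hif : (0 : ℝ) ≤ if x = o then p else 0 := by split_ifs <;> positivity
    by_cases hxy : x = y
    · have : T x y = ∅ := by ext ω; simp [hT, hxy]
      rw [this]; simp; positivity
    · by_cases hx : x = o
      · rw [if_pos hx]
        have : P.real (T x y) ≤ P.real {ω | y ∈ A ω} := measureReal_mono fun ω hω => hω.2.1
        rw [h.measureReal_mem] at this
        nlinarith [sq_nonneg p]
      · rw [if_neg hx, add_zero, ← h.measureReal_mem_inter hxy]
        exact measureReal_mono fun ω hω => ⟨hω.1.resolve_right hx, hω.2.1⟩
  simp only [he]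
  refine ⟨integrable_finsetSum _ fun x _ => hi' x, ?_⟩
  rw [integral_finsetSum _ fun x _ => hi' x]
  calc _ = ∑ x, ∑ y, ∫ ω, (T x y).indicator (fun _ => |greenDev q x y|) ω ∂P :=
        Finset.sum_congr rfl fun x _ => integral_finsetSum _ fun y _ => hi x y
    _ ≤ ∑ x : Cube n, ∑ y : Cube n, (p ^ 2 + if x = o then p else 0) * |greenDev q x y| :=
        Finset.sum_le_sum fun x _ => Finset.sum_le_sum fun y _ => by
          rw [integral_indicator_const _ (hTm x y), smul_eq_mul]
          gcongr
          exact hprob x y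
    _ ≤ ∑ x : Cube n, (p ^ 2 + if x = o then p else 0) * (n * √(2 ^ n)) :=
        Finset.sum_le_sum fun x _ => by
          rw [← Finset.mul_sum]
          gcongr
          exact sum_abs_greenDev_le hn hq0 hq1 x
    _ = _ := by
        rw [← Finset.sum_mul, Finset.sum_add_distrib]
        simp

end CloudLemmas

/-! ### Passing from rational to real arguments, and elementary limits -/

section Limits

/-- Uniform convergence of monotone functions of `s` to a continuous limit at all rational `s`
gives convergence at all real `s`. -/
lemma tendsto_iSup_abs_sub_of_rat {ι : ℕ → Type*} [∀ n, Finite (ι n)] [∀ n, Nonempty (ι n)]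
    {L : (n : ℕ) → ι n → ℝ → ℝ} {φ : ℝ → ℝ}
    (hL : ∀ n i s t, 0 < s → s ≤ t → L n i t ≤ L n i s) (hφ : ContinuousOn φ (Set.Ioi 0))
    (h : ∀ s : ℚ, 0 < s → Tendsto (fun n => ⨆ i, |L n i s - φ s|) atTop (𝓝 0))
    {s : ℝ} (hs : 0 < s) : Tendsto (fun n => ⨆ i, |L n i s - φ s|) atTop (𝓝 0) := by
  rw [Metric.tendsto_atTop']
  intro ε hε
  obtain ⟨δ, hδ, hδφ⟩ := Metric.continuousAt_iff.1 (hφ.continuousAt (Ioi_mem_nhds hs)) (ε / 8)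
    (by positivity)
  -- Monotonicity squeezes the value at `s` between those at rationals `a < s < b`, where `φ` is
  -- within `ε / 8` of `φ s`.
  obtain ⟨a, ha1, ha2⟩ := exists_rat_btwn (max_lt (sub_lt_self s hδ) hs)
  obtain ⟨b, hb1, hb2⟩ := exists_rat_btwn (lt_add_of_pos_right s hδ)
  have ha0 : (0 : ℝ) < a := (le_max_right _ _).trans_lt ha1
  have hb0 : (0 : ℝ) < b := hs.trans hb1
  have hφa : |φ a - φ s| < ε / 8 := hδφ (by
    rw [Real.dist_eq, abs_lt]
    have := (le_max_left (s - δ) 0).trans_lt ha1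
    constructor <;> linarith)
  have hφb : |φ b - φ s| < ε / 8 := hδφ (by
    rw [Real.dist_eq, abs_lt]; constructor <;> linarith)
  have e1 := (h a (by exact_mod_cast ha0)).eventually (gt_mem_nhds (show 0 < ε / 8 by positivity))
  have e2 := (h b (by exact_mod_cast hb0)).eventually (gt_mem_nhds (show 0 < ε / 8 by positivity))
  obtain ⟨N, hN⟩ := eventually_atTop.1 (e1.and e2)
  refine ⟨N, fun n hn => ?_⟩
  obtain ⟨h1, h2⟩ := hN n hn.le
  rw [Real.dist_0_eq_abs, abs_of_nonneg (Real.iSup_nonneg fun i => abs_nonneg _)]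
  refine (ciSup_le fun i => ?_).trans_lt (show ε / 2 < ε by linarith)
  have h3 := (le_ciSup (Set.finite_range fun i => |L n i a - φ a|).bddAbove i).trans_lt h1
  have h4 := (le_ciSup (Set.finite_range fun i => |L n i b - φ b|).bddAbove i).trans_lt h2
  have h5 := hL n i a s ha0 ha2.le
  have h6 := hL n i s b hs hb1.le
  simp only [abs_lt] at h3 h4 hφa hφb
  rw [abs_le]
  constructor <;> linarith

/-- `ε / (1 - exp (-s ε)) → 1 / s` as `ε → 0`. -/
lemma tendsto_div_one_sub_exp {s : ℝ} (hs : 0 < s) :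
    Tendsto (fun ε : ℝ => ε / (1 - Real.exp (-(s * ε)))) (𝓝[≠] 0) (𝓝 (1 / s)) := by
  have hd : HasDerivAt (fun ε : ℝ => 1 - Real.exp (-(s * ε))) s 0 := by
    have h1 : HasDerivAt (fun ε : ℝ => -(s * ε)) (-s) 0 := by
      simpa only [neg_mul, mul_one] using (hasDerivAt_id' (0 : ℝ)).const_mul (-s)
    simpa using h1.exp.const_sub 1
  have h2 := (hasDerivAt_iff_tendsto_slope.1 hd).inv₀ hs.ne'
  rw [one_div]
  refine h2.congr fun ε => ?_
  simp [slope_def_field]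

lemma summable_natCast_mul_pow {a : ℝ} (h0 : 0 ≤ a) (h1 : a < 1) :
    Summable fun n : ℕ => (n : ℝ) * a ^ n := by
  simpa using summable_pow_mul_geometric_of_norm_lt_one 1 (r := a)
    (by rwa [Real.norm_eq_abs, abs_of_nonneg h0])

end Limits

/-! ### Almost sure convergence on the cube -/

section CubeClouds

/-- The hitting times of Poisson clouds of density `ρ₀ * R ^ n` on the cube are asymptotically
exponential, for one value of the argument of the Laplace transform. -/
lemma ae_tendsto_iSup_hittingLaplace {R : ℝ} (hR0 : 0 < R) (hR1 : 1 < 2 * R)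
    (hR2 : 2 * √2 * R ^ 2 < 1) {ρ₀ : ℝ} (hρ : 0 < ρ₀) {Ω : Type*} [MeasurableSpace Ω]
    {P : Measure Ω} [IsProbabilityMeasure P] {A : (n : ℕ) → Ω → Set (Cube n)}
    (o : (n : ℕ) → Cube n)
    (hA : ∀ᶠ n in atTop, IsPoissonCloud P (A n) (ρ₀ * R ^ n)) {s : ℝ} (hs : 0 < s) :
    ∀ᵐ ω ∂P, Tendsto (fun n => ⨆ x : ↥(A n ω ∪ {o n}),
      |hittingLaplace (cubeGraph n) (x : Cube n) (A n ω \ {(x : Cube n)}) (s * R ^ n)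
        - ρ₀ / (s + ρ₀)|) atTop (𝓝 0) := by
  have hs2 : (1 : ℝ) < √2 := by
    rw [Real.lt_sqrt zero_le_one]; norm_num
  have hs2' : √2 * √2 = 2 := Real.mul_self_sqrt (by norm_num)
  have hR3 : √2 * R < 1 := by
    by_contra! h
    have : 1 * 1 ≤ (√2 * R) * (√2 * R) := mul_le_mul h h zero_le_one (by positivity)
    nlinarith [mul_pos (Real.sqrt_pos.2 (zero_lt_two' ℝ)) (pow_pos hR0 2), pow_pos hR0 2]
  have hR4 : R < 1 := by nlinarith
  have hRpow : Tendsto (fun n : ℕ => R ^ n) atTop (𝓝[≠] 0) :=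
    tendsto_nhdsWithin_iff.2 ⟨tendsto_pow_atTop_nhds_zero_of_lt_one hR0.le hR4,
      Eventually.of_forall fun n => (pow_pos hR0 n).ne'⟩
  -- The expected number of cloud points, once the cloud is Poisson.
  set m : ℕ → ℝ := fun n => 2 ^ n * (ρ₀ * R ^ n) with hm
  have hm0 : ∀ n, 0 < m n := fun n => by positivity
  have hminv : ∀ n, (m n)⁻¹ = ρ₀⁻¹ * (2 * R)⁻¹ ^ n := fun n => by
    simp only [hm, mul_inv, inv_pow, mul_pow]; ring
  have hR5 : (2 * R)⁻¹ < 1 := inv_lt_one_of_one_lt₀ hR1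
  set q : ℕ → ℝ := fun n => Real.exp (-(s * R ^ n)) with hq
  have hq1 : ∀ n, q n < 1 := fun n => Real.exp_lt_one_iff.2 (by
    have : 0 < s * R ^ n := by positivity
    linarith)
  -- The variance is at most `m n`, so the relative variance is at most `(m n)⁻¹`, geometric because
  -- `2 * R > 1`.
  have hcount : ∀ᵐ ω ∂P, Tendsto (fun n => (((A n ω).ncard : ℝ) / m n - 1) ^ 2) atTop (𝓝 0) := by
    refine ae_tendsto_zero_of_summable_integral (b := fun n => ρ₀⁻¹ * (2 * R)⁻¹ ^ n)
      (fun _ _ => sq_nonneg _) ?_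
      ((summable_geometric_of_lt_one (by positivity) hR5).mul_left _)
    filter_upwards [hA] with n hn
    have h1 := hn.integral_ncard_sub_sq_le
    simp only [card_cube, Nat.cast_pow, Nat.cast_ofNat] at h1
    have he : ∀ ω, (((A n ω).ncard : ℝ) / m n - 1) ^ 2
        = (((A n ω).ncard : ℝ) - 2 ^ n * (ρ₀ * R ^ n)) ^ 2 * ((m n)⁻¹ ^ 2) := fun ω => by
      have := (hm0 n).ne'
      change _ = (((A n ω).ncard : ℝ) - m n) ^ 2 * ((m n)⁻¹ ^ 2)
      field_simp
    simp only [he]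
    refine ⟨h1.1.mul_const _, ?_⟩
    rw [integral_mul_const, ← hminv]
    calc _ ≤ m n * (m n)⁻¹ ^ 2 := by gcongr; exact h1.2
      _ = (m n)⁻¹ := by have := (hm0 n).ne'; field_simp
  -- The first series bounds pairs of cloud points and is where `2 * √2 * R ^ 2 < 1` is
  -- indispensable; the second accounts for the start `o n`.
  have hpair : ∀ᵐ ω ∂P, Tendsto (fun n => pairDev (q n) (A n ω) (o n)) atTop (𝓝 0) := by
    refine ae_tendsto_zero_of_summable_integral
      (b := fun n => ρ₀ ^ 2 * (n * (2 * √2 * R ^ 2) ^ n) + ρ₀ * (n * (√2 * R) ^ n))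
      (fun _ _ => pairDev_nonneg _ _ _) ?_
      (((summable_natCast_mul_pow (by positivity) hR2).mul_left _).add
        ((summable_natCast_mul_pow (by positivity) hR3).mul_left _))
    filter_upwards [hA, eventually_ge_atTop 1] with n hn hn1
    have h1 := hn.integral_pairDev_le hn1 (Real.exp_pos (-(s * R ^ n))) (hq1 n) (o n)
    refine ⟨h1.1, h1.2.trans (le_of_eq ?_)⟩
    have h2 : √((2 : ℝ) ^ n) = √2 ^ n := by
      rw [Real.sqrt_eq_iff_mul_self_eq (by positivity) (by positivity), ← mul_pow, hs2']
    rw [h2]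
    simp only [mul_pow, ← pow_mul]
    ring
  have hmw : Tendsto (fun n => m n * ((2 ^ n)⁻¹ / (1 - q n))) atTop (𝓝 (ρ₀ / s)) := by
    have h1 := ((tendsto_div_one_sub_exp hs).comp hRpow).const_mul ρ₀
    rw [mul_one_div] at h1
    refine h1.congr fun n => ?_
    have : (0 : ℝ) < 2 ^ n := by positivity
    simp only [hm, hq, Function.comp_apply]
    field_simp
  have hw : Tendsto (fun n => (2 ^ n)⁻¹ / (1 - q n)) atTop (𝓝 0) := by
    have h1 : Tendsto (fun n => (m n)⁻¹) atTop (𝓝 0) := by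
      simp only [hminv]
      simpa using (tendsto_pow_atTop_nhds_zero_of_lt_one (by positivity) hR5).const_mul ρ₀⁻¹
    have h2 := h1.mul hmw
    rw [zero_mul] at h2
    refine h2.congr fun n => ?_
    rw [← mul_assoc, inv_mul_cancel₀ (hm0 n).ne', one_mul]
  filter_upwards [hcount, hpair] with ω h1 h2
  have h3 : Tendsto (fun n => ((A n ω).ncard : ℝ) / m n) atTop (𝓝 1) := by
    have h4 := h1.sqrt
    simp only [Real.sqrt_sq_eq_abs, Real.sqrt_zero] at h4
    simpa using ((tendsto_zero_iff_abs_tendsto_zero _).2 h4).add_const 1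
  have h4 : Tendsto (fun n => ((A n ω).ncard : ℝ) * ((2 ^ n)⁻¹ / (1 - q n))) atTop
      (𝓝 (ρ₀ / s)) := by
    have h5 := h3.mul hmw
    rw [one_mul] at h5
    refine h5.congr fun n => ?_
    rw [← mul_assoc, div_mul_cancel₀ _ (hm0 n).ne']
  have h5 : Tendsto (fun n => |((A n ω).ncard : ℝ) * ((2 ^ n)⁻¹ / (1 - q n))
      / (1 + (A n ω).ncard * ((2 ^ n)⁻¹ / (1 - q n))) - ρ₀ / (s + ρ₀)|) atTop (𝓝 0) := by
    have h6 : (1 : ℝ) + ρ₀ / s ≠ 0 := by positivity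
    have h7 := h4.div (h4.const_add 1) h6
    have h8 : ρ₀ / s / (1 + ρ₀ / s) = ρ₀ / (s + ρ₀) := by field_simp
    rw [h8] at h7
    simpa using (h7.sub_const (ρ₀ / (s + ρ₀))).abs
  have h6 := (((tendsto_const_div_atTop_nhds_zero_nat (4 : ℝ)).add (h2.const_mul 2)).add hw).add h5
  simp only [mul_zero, add_zero] at h6
  refine squeeze_zero' (Eventually.of_forall fun n => Real.iSup_nonneg fun _ => abs_nonneg _) ?_ h6
  filter_upwards [eventually_ge_atTop 1] with n hn
  have : Nonempty ↥(A n ω ∪ {o n}) := ⟨⟨o n, Or.inr rfl⟩⟩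
  refine ciSup_le fun x => ?_
  have h7 := abs_hittingLaplace_cube_sub_le hn (show 0 < s * R ^ n by positivity) (A n ω) x.2
  exact (abs_sub_le _ _ _).trans (add_le_add h7 le_rfl)

end CubeClouds

end TrapModel

/-! ### The scales of the Random Energy Model -/

theorem corollaryc (α β : ℝ) (hα : 0 < α) (hβ : 0 < β)
    (hlow : 3 / 4 < α ^ 2 * β ^ 2 / (2 * Real.log 2))
    (hup : α ^ 2 * β ^ 2 / (2 * Real.log 2) < 1) :
    TrapModel.ConditionC.{u} TrapModel.Cube TrapModel.cubeGraph TrapModel.cubeOrigin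
      (TrapModel.remT α β) (TrapModel.remG α β) (TrapModel.remRho α β) (TrapModel.remR α β) 1 := by
  have hlog : 0 < Real.log 2 := Real.log_pos one_lt_two
  rw [lt_div_iff₀ (by positivity)] at hlow
  rw [div_lt_one (by positivity)] at hup
  refine ⟨one_pos, fun n hn => ?_, fun ρ₀ hρ Ω _ P _ A hA => ?_⟩
  · have hn' : (0 : ℝ) < n := by exact_mod_cast hn
    have hg : TrapModel.remG α β n ≠ 0 := by
      unfold TrapModel.remG
      positivity
    rw [TrapModel.remT, div_self hg, TrapModel.remRho,
      mul_inv_cancel₀ (show TrapModel.remR α β n ≠ 0 from (Real.exp_pos _).ne')]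
  · set R : ℝ := Real.exp (-(α ^ 2 * β ^ 2 / 2)) with hR
    have hR0 : 0 < R := Real.exp_pos _
    have hr : ∀ n, (TrapModel.remR α β n)⁻¹ = R ^ n := fun n => by
      rw [TrapModel.remR, hR, ← Real.exp_neg, ← Real.exp_nat_mul]
      congr 1; ring
    have h2 : Real.exp (Real.log 2) = 2 := Real.exp_log two_pos
    -- This is the upper bound `α²β² < 2 log 2`.
    have hR1 : 1 < 2 * R := by
      rw [← h2, hR, ← Real.exp_add, Real.one_lt_exp_iff]
      linarith
    -- This is the lower bound `α²β² > (3/2) log 2`.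
    have hR2 : 2 * √2 * R ^ 2 < 1 := by
      have h3 : √2 = Real.exp (Real.log 2 / 2) := by rw [Real.exp_half, h2]
      calc 2 * √2 * R ^ 2
          = Real.exp (Real.log 2 + Real.log 2 / 2 - α ^ 2 * β ^ 2) := by
            rw [h3, hR, sub_eq_add_neg, Real.exp_add, Real.exp_add, h2, ← Real.exp_nat_mul]
            congr 2; push_cast; ring
        _ < 1 := Real.exp_lt_one_iff.2 (by linarith)
    simp only [TrapModel.remRho, hr] at hA
    have hrat : ∀ᵐ ω ∂P, ∀ s : ℚ, 0 < s → Tendsto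
        (fun n => ⨆ x : ↥(A n ω ∪ {TrapModel.cubeOrigin n}),
        |TrapModel.hittingLaplace (TrapModel.cubeGraph n) (x : TrapModel.Cube n)
          (A n ω \ {(x : TrapModel.Cube n)}) (s * R ^ n) - ρ₀ / (s + ρ₀)|) atTop (𝓝 0) := by
      rw [ae_all_iff]
      intro s
      by_cases hs : 0 < s
      · filter_upwards [TrapModel.ae_tendsto_iSup_hittingLaplace hR0 hR1 hR2 hρ
          TrapModel.cubeOrigin hA (s := s) (by exact_mod_cast hs)] with ω h _ using h
      · exact Eventually.of_forall fun ω h => absurd h hs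
    filter_upwards [hrat] with ω h s hs
    have : ∀ n, Nonempty ↥(A n ω ∪ {TrapModel.cubeOrigin n}) := fun n => ⟨⟨_, Or.inr rfl⟩⟩
    have hfin := TrapModel.tendsto_iSup_abs_sub_of_rat
      (ι := fun n => ↥(A n ω ∪ {TrapModel.cubeOrigin n}))
      (L := fun n x s => TrapModel.hittingLaplace (TrapModel.cubeGraph n) (x : TrapModel.Cube n)
        (A n ω \ {(x : TrapModel.Cube n)}) (s * R ^ n)) (φ := fun s => ρ₀ / (s + ρ₀))
      (fun n x s t hs hst => TrapModel.hittingLaplace_antitone _ _ _ (by positivity) (by gcongr))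
      (ContinuousOn.div continuousOn_const (by fun_prop) fun t ht => by
        have : 0 < t := ht
        positivity) h hs
    simpa only [div_eq_mul_inv _ (TrapModel.remR α β _), hr, one_mul] using hfin
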